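/- A finite semigroup $S$ is \emph{3-nilpotent} if it has a zero element $0$, $xyz=0$ for all $x,y,z\in S$, and $ab\neq 0$ for some $a,b\in S$. It is \emph{semirigid} if every automorphism of $S$ fixes every element of $S^2=\{ab : a,b\in S\}$. Let $\genfrac\{\}{0pt}{}{m}{k}$ denote the Stirling number of the second kind. For an integer partition $\lambda\vdash r$ with parts listed with multiplicity as $\lambda_1,\dots,\lambda_s$, put $$\beta(\lambda)=\sum_{1\le i,j\le s}\gcd(\lambda_i,\lambda_j),\qquad \delta(\lambda)=\sum_{i=1}^{s}\bigl(1+e(\lambda_i)\bigr),\qquad \gamma(\lambda)=\tfrac12\bigl(\beta(\lambda)+\delta(\lambda)\bigr),$$ where $e(m)=1$ if $m$ is even and $e(m)=0$ if $m$ is odd; and let $w(\lambda)=\prod_{a} a^{\mu_a}\,\mu_a!$, the product over the distinct parts $a$ of $\lambda$, where $\mu_a$ is the multiplicity of $a$ in $\lambda$. \textbf{Theorem.} For every $n$, the number of isomorphism classes of semirigid commutative 3-nilpotent semigroups of order $n$ is at most $$\sum_{r=1}^{n-2}\ \sum_{\lambda\vdash r}\frac{\genfrac\{\}{0pt}{}{\gamma(\lambda)+1}{n-r}}{w(\lambda)}$$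 (an empty sum, equal to $0$, when $n\le 2$). Moreover, for every permutation $\pi$ of $X=\{1,\dots,r\}$ with cycle type $\lambda$ (fixed points counted as parts equal to $1$), $\beta(\lambda)$ is the number of c-cycles of $\pi$, i.e. of orbits of $(x,y)\mapsto(x\pi,y\pi)$ on $X\times X$, and $\delta(\lambda)$ is the number of symmetric c-cycles, i.e. of those c-cycles $\Gamma$ for which $(x,y)\in\Gamma$ implies $(y,x)\in\Gamma$. -/

import Mathlib

namespace SemirigidComm

/-- `S` is 3-nilpotent: it has a zero element `z`, every product of three elements is `z`,
and some product of two elements is not `z` (that is, `S³ = 0` and `S² ≠ 0`). -/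
def IsThreeNilpotent (S : Type*) [Semigroup S] : Prop :=
  ∃ z : S, (∀ a : S, z * a = z ∧ a * z = z) ∧ (∀ a b c : S, a * b * c = z) ∧
    ∃ a b : S, a * b ≠ z

/-- The set `S²` of all products of two elements of `S`. -/
def square (S : Type*) [Semigroup S] : Set S := {s | ∃ a b : S, a * b = s}

/-- `S` is semirigid: every automorphism of `S` fixes every element of `S²`. -/
def IsSemirigid (S : Type*) [Semigroup S] : Prop :=
  ∀ φ : S ≃* S, ∀ s ∈ square S, φ s = s

/-- `S` is commutative. -/
def IsCommutative (S : Type*) [Semigroup S] : Prop := ∀ a b : S, a * b = b * a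

/-- The semirigid commutative 3-nilpotent semigroup operations on the `n`-element set `Fin n`. -/
def Operation (n : ℕ) : Type :=
  {s : Semigroup (Fin n) //
    @IsThreeNilpotent (Fin n) s ∧ @IsCommutative (Fin n) s ∧ @IsSemirigid (Fin n) s}

/-- Isomorphism of semigroups, as an equivalence relation. -/
def isoSetoid (n : ℕ) : Setoid (Operation n) where
  r s t := Nonempty (@MulEquiv (Fin n) (Fin n) s.1.toMul t.1.toMul)
  iseqv :=
    { refl := fun s => ⟨@MulEquiv.refl (Fin n) s.1.toMul⟩
      symm := fun {s t} ⟨e⟩ => ⟨@MulEquiv.symm (Fin n) (Fin n) s.1.toMul t.1.toMul e⟩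
      trans := fun {s t u} ⟨e⟩ ⟨f⟩ =>
        ⟨@MulEquiv.trans (Fin n) (Fin n) (Fin n) s.1.toMul t.1.toMul u.1.toMul e f⟩ }

/-- The isomorphism classes of semirigid commutative 3-nilpotent semigroups of order `n`. -/
def IsoClass (n : ℕ) : Type := Quotient (isoSetoid n)

theorem finite_operation (n : ℕ) : Finite (Operation n) := by
  refine Finite.of_injective
    (fun s : Operation n => fun a b : Fin n => @HMul.hMul _ _ _ (@instHMul _ s.1.toMul) a b) ?_
  intro s t h
  apply Subtype.ext
  apply Semigroup.ext
  funext a b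
  exact congrFun (congrFun h a) b

/-- There are finitely many classes, so that `Nat.card (IsoClass n)` is their true number. -/
instance finite_isoClass (n : ℕ) : Finite (IsoClass n) :=
  haveI := finite_operation n
  inferInstanceAs (Finite (Quotient (isoSetoid n)))

/-- `β(λ) = ∑_{i,j} gcd(λᵢ, λⱼ)`, summed over all ordered pairs of parts of `λ`
(with multiplicity). -/
def beta {r : ℕ} (l : r.Partition) : ℕ :=
  (l.parts.map fun a => (l.parts.map fun b => Nat.gcd a b).sum).sum

/-- `δ(λ) = ∑ᵢ (1 + e(λᵢ))`, summed over all parts of `λ` (with multiplicity), where `e(m)` is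
`1` for even `m` and `0` for odd `m`. -/
def delta {r : ℕ} (l : r.Partition) : ℕ :=
  (l.parts.map fun a => 1 + if Even a then 1 else 0).sum

/-- `γ(λ) = (β(λ) + δ(λ)) / 2`. -/
def gamma {r : ℕ} (l : r.Partition) : ℕ := (beta l + delta l) / 2

/-- The division in the definition of `gamma` is exact. -/
theorem two_mul_gamma {r : ℕ} (l : r.Partition) : 2 * gamma l = beta l + delta l := by
  have key : ∀ m : Multiset ℕ, Even ((m.map fun a => (m.map fun b => Nat.gcd a b).sum).sum +
      (m.map fun a => 1 + if Even a then 1 else 0).sum) := by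
    intro m
    induction m using Multiset.induction_on with
    | empty => simp
    | cons a m ih =>
      simp only [Multiset.map_cons, Multiset.sum_cons, Nat.gcd_self, Multiset.sum_map_add]
      have hc : (m.map fun b => Nat.gcd b a) = m.map fun b => Nat.gcd a b := by
        simp only [Nat.gcd_comm]
      rw [hc]
      simp only [Multiset.sum_map_add] at ih
      by_cases ha : Even a <;> simp only [ha, if_true, if_false] <;> grind
  exact Nat.two_mul_div_two_of_even (key l.parts)

/-- `w(λ) = λ₁^μ₁ ⋯ λₜ^μₜ μ₁! ⋯ μₜ!`, where `λ₁, …, λₜ` are the distinct parts of `λ` and `μᵢ` is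
the multiplicity of `λᵢ`. -/
def weight {r : ℕ} (l : r.Partition) : ℕ :=
  ∏ a ∈ l.parts.toFinset, a ^ l.parts.count a * (l.parts.count a).factorial

/-- The c-cycle of `p`: its orbit under the cartesian action `(x, y) ↦ (π x, π y)` on `X × X`. -/
def cCycle {X : Type*} (π : Equiv.Perm X) (p : X × X) : Set (X × X) :=
  {q | Equiv.Perm.SameCycle (Equiv.prodCongr π π) p q}

/-- The set of all c-cycles of `π` (those of length one included). -/
def cCycles {X : Type*} (π : Equiv.Perm X) : Set (Set (X × X)) := Set.range (cCycle π)

/-- A subset `A` of `X × X` is symmetrical if `(x, y) ∈ A` implies `(y, x) ∈ A`. -/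
def IsSymmetrical {X : Type*} (A : Set (X × X)) : Prop :=
  ∀ x y : X, (x, y) ∈ A → (y, x) ∈ A

end SemirigidComm

/-! ### Counting c-cycles and their symmetrical unions. -/

namespace SemirigidComm

section

open Function Finset

/-! By Burnside, `n!` times the number of classes is the number of pairs `(σ, s)` with `σ` an
automorphism of the operation `s`. Sort these pairs by the set of products `U` and the zero `z`.
Products annihilate everything, so `s` is determined by `z` and its restriction `g : V × V → U`,
where `V` is the complement of `U` and `r = |V|`. Semirigidity makes `σ` the identity on `U`, so `σ`
is determined by its restriction `π` to `V`. Moreover `g (π x, π y) = g (x, y)`, so by commutativity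
`g` is constant on each union of a c-cycle with its mirror image, and `g` takes every value in `U`
except possibly `z`.

There are `γ(λ)` such unions when `π` has cycle type `λ` (`ncard_range_symCycle`), and hence `(|U| -
1)! S(γ(λ) + 1, |U|)` such functions (`card_coversExcept`). Exactly `r!/w(λ)` permutations have type
`λ`. The choices of `z` and `U` contribute `|U|` and `n!/(|U|! r!)`, after which all factorials
cancel against `n!`.

The values of `β`, `δ` and `γ` all come from one device: the number of classes of an equivalence
relation is the sum over all elements of the reciprocal of the size of the class. -/

theorem ncard_classes_eq_sum {α : Type*} [Fintype α] (cls : α → Set α)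
    (h : ∀ x y, y ∈ cls x ↔ cls y = cls x) (P : Set α → Prop) [DecidablePred P] :
    (({A ∈ Set.range cls | P A}.ncard : ℕ) : ℚ) =
      ∑ x, (if P (cls x) then 1 else 0) / ((cls x).ncard : ℚ) := by
  classical
  -- A class `A` has `|A|` elements, each contributing `1/|A|`.
  have key : ∀ A ∈ univ.image cls,
      ∑ x with cls x = A, (if P (cls x) then (1 : ℚ) else 0) / ((cls x).ncard : ℚ) =
        if P A then 1 else 0 := by
    intro A hA
    obtain ⟨a, -, rfl⟩ := mem_image.1 hA
    rw [sum_congr rfl (g := fun _ => (if P (cls a) then (1 : ℚ) else 0) / ((cls a).ncard : ℚ))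
      (by intro x hx; rw [(mem_filter.1 hx).2]), sum_const]
    have h1 : #{x | cls x = cls a} = (cls a).ncard := by
      rw [← Set.ncard_coe_finset]
      congr 1
      ext x
      simp [h]
    have h2 : (cls a).ncard ≠ 0 :=
      (Set.ncard_pos (Set.toFinite _)).2 ⟨a, (h a a).2 rfl⟩ |>.ne'
    rw [h1, nsmul_eq_mul]
    field_simp
  rw [← sum_fiberwise_of_maps_to (t := univ.image cls) (g := cls) (by simp), sum_congr rfl key,
    sum_ite, sum_const_zero, add_zero, sum_const, nsmul_eq_mul, mul_one, ← Set.ncard_coe_finset]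
  congr 2
  ext A
  simp

theorem ncard_range_classes_eq_sum {α : Type*} [Fintype α] (cls : α → Set α)
    (h : ∀ x y, y ∈ cls x ↔ cls y = cls x) :
    (((Set.range cls).ncard : ℕ) : ℚ) = ∑ x, 1 / ((cls x).ncard : ℚ) := by
  have := ncard_classes_eq_sum cls h (fun _ => True)
  simp only [and_true, if_true] at this
  exact this

section Perm

variable {α : Type*}

theorem ncard_sameCycle [Fintype α] (π : Equiv.Perm α) (x : α) :
    {y | π.SameCycle x y}.ncard = minimalPeriod π x := by
  classical
  have := MulAction.minimalPeriod_eq_card (a := π) (b := x)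
  rw [show ((π • ·) : α → α) = π from rfl] at this
  rw [this, ← Nat.card_eq_fintype_card, ← Nat.card_coe_set_eq]
  congr 2
  ext y
  simp only [Set.mem_ofPred_eq, MulAction.mem_orbit_iff, Subgroup.exists_zpowers, Equiv.Perm.SameCycle]
  rfl

theorem minimalPeriod_pos [Fintype α] (π : Equiv.Perm α) (x : α) : 0 < minimalPeriod π x := by
  rw [← ncard_sameCycle]
  exact (Set.ncard_pos (Set.toFinite _)).2 ⟨x, Equiv.Perm.SameCycle.refl _ _⟩

theorem ncard_cCycle [Fintype α] (π : Equiv.Perm α) (p : α × α) :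
    (cCycle π p).ncard = (minimalPeriod π p.1).lcm (minimalPeriod π p.2) := by
  rw [← minimalPeriod_prodMap]
  exact ncard_sameCycle (Equiv.prodCongr π π) p

/-- A cycle of length `m` consists of `m` points of period `m`, which contribute `f m` together.
Fixed points are the parts equal to `1`, which `cycleType` omits and `partition` restores. -/
theorem sum_div_minimalPeriod [Fintype α] [DecidableEq α] (π : Equiv.Perm α) (f : ℕ → ℚ) :
    ∑ x, f (minimalPeriod π x) / (minimalPeriod π x : ℚ) = (π.partition.parts.map f).sum := by
  have hcyc : ∀ c ∈ π.cycleFactorsFinset, ∀ x ∈ c.support,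
      minimalPeriod π x = #c.support := by
    intro c hc x hx
    rw [← ncard_sameCycle, ← Set.ncard_coe_finset]
    congr 1
    ext y
    have hx' : x ∈ π.support := Equiv.Perm.mem_cycleFactorsFinset_support_le hc hx
    rw [Equiv.Perm.cycle_is_cycleOf hx hc]
    rw [Finset.mem_coe, Equiv.Perm.mem_support_cycleOf_iff]
    exact (and_iff_left hx').symm
  have hfix : ∀ x ∈ π.supportᶜ, f (minimalPeriod π x) / (minimalPeriod π x : ℚ) = f 1 := by
    intro x hx
    have : minimalPeriod π x = 1 := by
      rw [minimalPeriod_eq_one_iff_isFixedPt]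
      exact Equiv.Perm.notMem_support.1 (mem_compl.1 hx)
    simp [this]
  have hsup : π.support = π.cycleFactorsFinset.biUnion Equiv.Perm.support := by
    ext x
    simp only [mem_biUnion]
    exact Equiv.Perm.mem_support_iff_mem_support_of_mem_cycleFactorsFinset
  rw [← sum_add_sum_compl π.support, sum_congr rfl hfix, sum_const, card_compl,
    Equiv.Perm.parts_partition, Multiset.map_add, Multiset.sum_add, Multiset.map_replicate,
    Multiset.sum_replicate]
  congr 1
  rw [hsup, sum_biUnion, Equiv.Perm.cycleType_def, Multiset.map_map]
  · apply sum_congr rfl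
    intro c hc
    rw [sum_congr rfl (g := fun _ => f #c.support / (#c.support : ℚ))
      (by intro x hx; rw [hcyc c hc x hx]), sum_const, nsmul_eq_mul]
    have : (#c.support : ℚ) ≠ 0 := by
      have := (Equiv.Perm.mem_cycleFactorsFinset_iff.1 hc).1.two_le_card_support
      exact_mod_cast (by omega)
    simp only [comp_apply]
    field_simp
  · intro c hc d hd hcd
    exact (Equiv.Perm.cycleFactorsFinset_pairwise_disjoint π hc hd hcd).disjoint_support

theorem mem_cCycle_iff (π : Equiv.Perm α) (p q : α × α) :
    q ∈ cCycle π p ↔ cCycle π q = cCycle π p := by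
  constructor
  · intro h
    ext r
    exact ⟨fun hr => Equiv.Perm.SameCycle.trans h hr,
      fun hr => Equiv.Perm.SameCycle.trans (Equiv.Perm.SameCycle.symm h) hr⟩
  · intro h
    rw [← h]
    exact Equiv.Perm.SameCycle.refl _ _

theorem mem_cCycle_iff_exists (π : Equiv.Perm α) (p q : α × α) :
    q ∈ cCycle π p ↔ ∃ k : ℤ, (π ^ k) p.1 = q.1 ∧ (π ^ k) p.2 = q.2 := by
  have hk : ∀ k : ℤ, ((Equiv.prodCongr π π : Equiv.Perm (α × α)) ^ k) p =
      ((π ^ k) p.1, (π ^ k) p.2) := by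
    intro k
    have hpow : ∀ (σ : Equiv.Perm α) (n : ℕ) (p : α × α),
        ((Equiv.prodCongr σ σ : Equiv.Perm (α × α)) ^ n) p = ((σ ^ n) p.1, (σ ^ n) p.2) := by
      intro σ n
      induction n with
      | zero => intro p; rfl
      | succ n ih => intro p; rw [pow_succ, Equiv.Perm.mul_apply, ih]; rfl
    cases k with
    | ofNat n => simpa using hpow π n p
    | negSucc n =>
      rw [zpow_negSucc, zpow_negSucc, ← inv_pow, ← inv_pow]
      exact hpow π⁻¹ (n + 1) p
  change (∃ k : ℤ, _) ↔ _
  simp only [hk, Prod.ext_iff]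

theorem swap_mem_cCycle_swap (π : Equiv.Perm α) {p q : α × α} (h : q ∈ cCycle π p) :
    q.swap ∈ cCycle π p.swap := by
  rw [mem_cCycle_iff_exists] at h ⊢
  obtain ⟨k, h1, h2⟩ := h
  exact ⟨k, h2, h1⟩

theorem isSymmetrical_cCycle_iff (π : Equiv.Perm α) (p : α × α) :
    IsSymmetrical (cCycle π p) ↔ p.swap ∈ cCycle π p := by
  constructor
  · exact fun h => h p.1 p.2 ((mem_cCycle_iff π p p).2 rfl)
  · intro h x y hxy
    have := swap_mem_cCycle_swap π hxy
    rwa [(mem_cCycle_iff π _ _).1 h] at this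

theorem zpow_apply_eq_self_iff (π : Equiv.Perm α) (x : α) (k : ℤ) :
    (π ^ k) x = x ↔ (minimalPeriod π x : ℤ) ∣ k :=
  MulAction.zpow_smul_eq_iff_minimalPeriod_dvd (a := π) (b := x)

theorem minimalPeriod_eq_of_swap_mem [Fintype α] (π : Equiv.Perm α) {x y : α}
    (h : (y, x) ∈ cCycle π (x, y)) : minimalPeriod π y = minimalPeriod π x := by
  rw [mem_cCycle_iff_exists] at h
  obtain ⟨k, h1, -⟩ := h
  rw [← ncard_sameCycle, ← ncard_sameCycle]
  have hxy : π.SameCycle x y := ⟨k, h1⟩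
  congr 1
  ext z
  exact ⟨hxy.trans, hxy.symm.trans⟩

/-- If `π ^ k` takes `x` to `y` and `y` back to `x`, the period of `x` divides `2 * k`. Modulo the
period, `k` is then `0` or, when the period is even, half of it. -/
theorem card_swap_mem_cCycle [Fintype α] (π : Equiv.Perm α) (x : α) :
    {y | (y, x) ∈ cCycle π (x, y)}.ncard = 1 + if Even (minimalPeriod π x) then 1 else 0 := by
  have hmem : ∀ y, (y, x) ∈ cCycle π (x, y) ↔ ∃ k : ℤ, (π ^ k) x = y ∧
      (minimalPeriod π x : ℤ) ∣ 2 * k := by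
    intro y
    rw [mem_cCycle_iff_exists]
    refine exists_congr fun k => and_congr_right ?_
    dsimp only
    rintro rfl
    rw [← zpow_apply_eq_self_iff, two_mul, zpow_add, Equiv.Perm.mul_apply]
  have hpos := minimalPeriod_pos π x
  simp only [hmem]
  split_ifs with he
  · obtain ⟨m, hm⟩ := he
    have : {y | ∃ k : ℤ, (π ^ k) x = y ∧ (minimalPeriod π x : ℤ) ∣ 2 * k} =
        {x, (π ^ (m : ℤ)) x} := by
      ext y
      simp only [Set.mem_ofPred_eq, Set.mem_insert_iff, Set.mem_singleton_iff]
      constructor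
      · rintro ⟨k, rfl, hk⟩
        have hk' : (m : ℤ) ∣ k := by
          rw [hm] at hk
          push_cast at hk
          rw [← two_mul] at hk
          exact Int.dvd_of_mul_dvd_mul_left (by norm_num) hk
        obtain ⟨j, rfl⟩ := hk'
        rcases Int.even_or_odd' j with ⟨i, rfl | rfl⟩
        · left
          rw [zpow_apply_eq_self_iff, hm]
          exact ⟨i, by push_cast; ring⟩
        · right
          have : (π ^ ((m : ℤ) * (2 * i))) x = x := by
            rw [zpow_apply_eq_self_iff, hm]
            exact ⟨i, by push_cast; ring⟩
          rw [mul_add, mul_one, add_comm, zpow_add, Equiv.Perm.mul_apply, this]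
      · rintro (rfl | rfl)
        · exact ⟨0, by simp⟩
        · exact ⟨m, rfl, by rw [hm]; push_cast; rw [two_mul]⟩
    rw [this, Set.ncard_pair]
    intro h
    have := (zpow_apply_eq_self_iff π x m).1 h.symm
    have := Int.le_of_dvd (by omega) this
    omega
  · have : {y | ∃ k : ℤ, (π ^ k) x = y ∧ (minimalPeriod π x : ℤ) ∣ 2 * k} = {x} := by
      ext y
      simp only [Set.mem_ofPred_eq, Set.mem_singleton_iff]
      constructor
      · rintro ⟨k, rfl, hk⟩
        rw [zpow_apply_eq_self_iff]
        refine IsCoprime.dvd_of_dvd_mul_left ?_ hk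
        rw [Nat.not_even_iff_odd] at he
        exact_mod_cast Nat.isCoprime_iff_coprime.2 he.coprime_two_right
      · rintro rfl
        exact ⟨0, by simp⟩
    rw [this, Set.ncard_singleton]

/-- The smallest symmetrical set of pairs that contains `p` and is closed under `π`. -/
def symCycle (π : Equiv.Perm α) (p : α × α) : Set (α × α) :=
  cCycle π p ∪ cCycle π p.swap

theorem mem_symCycle_iff (π : Equiv.Perm α) (p q : α × α) :
    q ∈ symCycle π p ↔ symCycle π q = symCycle π p := by
  constructor
  · have hp := mem_cCycle_iff π
    rintro (h | h)
    · rw [symCycle, symCycle, (hp _ _).1 h, (hp _ _).1 (swap_mem_cCycle_swap π h)]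
    · have h' := swap_mem_cCycle_swap π h
      rw [Prod.swap_swap] at h'
      rw [symCycle, symCycle, (hp _ _).1 h, (hp _ _).1 h', Set.union_comm]
  · intro h
    rw [← h]
    exact Or.inl ((mem_cCycle_iff π q q).2 rfl)

variable [Fintype α] [DecidableEq α]

/-- The orbit of `(x, y)` has length `lcm(a, b)` for periods `a`, `b`, and `1/lcm(a, b) = gcd(a,
b)/(a b)`; each of the two sums over points then becomes a sum over parts. -/
theorem sum_one_div_ncard_cCycle (π : Equiv.Perm α) :
    ∑ p, 1 / ((cCycle π p).ncard : ℚ) = beta π.partition := by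
  simp only [ncard_cCycle, Fintype.sum_prod_type]
  have h : ∀ a b : ℕ, 0 < a → 0 < b →
      1 / (a.lcm b : ℚ) = ((Nat.gcd a b : ℚ) / b) / a := by
    intro a b ha hb
    have h1 : (Nat.gcd a b : ℚ) * (Nat.lcm a b : ℚ) = a * b := by
      exact_mod_cast Nat.gcd_mul_lcm a b
    have h2 : (Nat.lcm a b : ℚ) ≠ 0 := by exact_mod_cast (Nat.lcm_pos ha hb).ne'
    have ha' : (a : ℚ) ≠ 0 := by exact_mod_cast ha.ne'
    have hb' : (b : ℚ) ≠ 0 := by exact_mod_cast hb.ne'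
    field_simp
    linarith
  have hin : ∀ x, ∑ y, 1 / ((minimalPeriod π x).lcm (minimalPeriod π y) : ℚ) =
      (π.partition.parts.map fun b => (Nat.gcd (minimalPeriod π x) b : ℚ)).sum /
        minimalPeriod π x := by
    intro x
    rw [← sum_div_minimalPeriod, sum_div]
    exact sum_congr rfl fun y _ => h _ _ (minimalPeriod_pos π x) (minimalPeriod_pos π y)
  simp only [hin]
  rw [sum_div_minimalPeriod π (fun a => (π.partition.parts.map fun b => (Nat.gcd a b : ℚ)).sum),
    beta]
  simp [Nat.cast_multiset_sum, Multiset.map_map]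

open Classical in
theorem sum_symmetrical_div_ncard_cCycle (π : Equiv.Perm α) :
    ∑ p, (if p.swap ∈ cCycle π p then 1 else 0) / ((cCycle π p).ncard : ℚ) =
      delta π.partition := by
  simp only [ncard_cCycle, Fintype.sum_prod_type, Prod.swap_prod_mk]
  have h : ∀ x : α, ∑ y, (if (y, x) ∈ cCycle π (x, y) then (1 : ℚ) else 0) /
      ((minimalPeriod π x).lcm (minimalPeriod π y) : ℚ) =
      ((1 + if Even (minimalPeriod π x) then 1 else 0 : ℕ) : ℚ) / (minimalPeriod π x : ℚ) := by
    intro x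
    rw [← card_swap_mem_cCycle, sum_congr rfl (g := fun y =>
      (if (y, x) ∈ cCycle π (x, y) then (1 : ℚ) else 0) / (minimalPeriod π x : ℚ)), ← sum_div]
    · congr 1
      rw [sum_boole, ← Set.ncard_coe_finset]
      simp
    · intro y _
      split_ifs with hy
      · rw [minimalPeriod_eq_of_swap_mem π hy, Nat.lcm_self]
      · simp
  simp only [h]
  rw [sum_div_minimalPeriod π (fun a => ((1 + if Even a then 1 else 0 : ℕ) : ℚ)), delta]
  simp [Nat.cast_multiset_sum, Multiset.map_map]

theorem ncard_cCycles (π : Equiv.Perm α) : (cCycles π).ncard = beta π.partition := by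
  have := ncard_range_classes_eq_sum (cCycle π) (mem_cCycle_iff π)
  rw [sum_one_div_ncard_cCycle] at this
  exact_mod_cast this

theorem ncard_symmetrical_cCycles (π : Equiv.Perm α) :
    {A ∈ cCycles π | IsSymmetrical A}.ncard = delta π.partition := by
  classical
  have := ncard_classes_eq_sum (cCycle π) (mem_cCycle_iff π) IsSymmetrical
  simp only [isSymmetrical_cCycle_iff] at this
  rw [sum_symmetrical_div_ncard_cCycle] at this
  exact_mod_cast this

/-- A class is either one symmetrical c-cycle or two disjoint mirror c-cycles of equal size. In both
cases its reciprocal size is the average of the terms that count c-cycles and symmetrical c-cycles.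
-/
theorem ncard_range_symCycle (π : Equiv.Perm α) :
    (Set.range (symCycle π)).ncard = gamma π.partition := by
  classical
  have h := ncard_range_classes_eq_sum (symCycle π) (mem_symCycle_iff π)
  have key : ∀ p, 1 / ((symCycle π p).ncard : ℚ) = (1 / ((cCycle π p).ncard : ℚ) +
      (if p.swap ∈ cCycle π p then 1 else 0) / ((cCycle π p).ncard : ℚ)) / 2 := by
    intro p
    split_ifs with hp
    · rw [symCycle, (mem_cCycle_iff π _ _).1 hp, Set.union_self]
      ring
    · have hd : Disjoint (cCycle π p) (cCycle π p.swap) := by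
        rw [Set.disjoint_left]
        intro q h1 h2
        apply hp
        rw [mem_cCycle_iff] at h1 h2 ⊢
        rw [← h2, h1]
      rw [symCycle, Set.ncard_union_eq hd (Set.toFinite _) (Set.toFinite _), ncard_cCycle,
        ncard_cCycle, Prod.fst_swap, Prod.snd_swap, Nat.lcm_comm (minimalPeriod π p.2)]
      push_cast
      rw [← two_mul, one_div, mul_inv]
      ring
  simp only [key, ← sum_div, sum_add_distrib] at h
  rw [sum_one_div_ncard_cCycle, sum_symmetrical_div_ncard_cCycle] at h
  have h2 : (2 * gamma π.partition : ℚ) = beta π.partition + delta π.partition := by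
    exact_mod_cast two_mul_gamma π.partition
  have : ((Set.range (symCycle π)).ncard : ℚ) = gamma π.partition := by linarith
  exact_mod_cast this

end Perm

end

end SemirigidComm

/-! ### Functions that miss at most one prescribed value. -/

namespace SemirigidComm

section

open Function Finset

/-- `f` takes every value other than `z`. -/
def CoversExcept {Q U : Type*} (z : U) (f : Q → U) : Prop := ∀ u, u ≠ z → ∃ q, f q = u

/-- If `f` needs the extra value `a` in order to cover, then `a ≠ z` and `a` is the one value `f`
misses, so `f` is a covering map into `U` without `a`. The `finsum` over `a ≠ z` supplies the proof
that `z` lies in this smaller codomain. -/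
theorem card_coversExcept_cons {Q U : Type*} [Finite Q] [Finite U] (z a : U) :
    Nat.card {f : Q → U // CoversExcept z fun o : Option Q => o.elim a f} =
      Nat.card {f : Q → U // CoversExcept z f} +
        ∑ᶠ h : a ≠ z, Nat.card {f : Q → {u // u ≠ a} // CoversExcept ⟨z, h.symm⟩ f} := by
  classical
  have hsub : ∀ f : Q → U, CoversExcept z f → CoversExcept z fun o : Option Q => o.elim a f :=
    fun f hf u hu => (hf u hu).imp' some fun _ => id
  have hsplit : Nat.card {f : Q → U // CoversExcept z fun o : Option Q => o.elim a f} =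
      Nat.card {f : Q → U // CoversExcept z f} +
      Nat.card {f : Q → U // (CoversExcept z fun o : Option Q => o.elim a f) ∧
        ¬ CoversExcept z f} := by
    rw [← Nat.card_sum]
    refine Nat.card_congr ?_
    refine (Equiv.sumCompl fun f : {f : Q → U // CoversExcept z fun o : Option Q => o.elim a f} =>
      CoversExcept z f.1).symm.trans (Equiv.sumCongr ?_ ?_)
    · exact Equiv.subtypeSubtypeEquivSubtype (fun {f} hf => hsub f hf)
    · exact Equiv.subtypeSubtypeEquivSubtypeInter _ (fun f => ¬ CoversExcept z f)
  rw [hsplit]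
  congr 1
  by_cases h : a = z
  · subst h
    simp only [ne_eq, not_true_eq_false, finsum_false]
    rw [Nat.card_eq_zero]
    left
    constructor
    rintro ⟨f, h1, h2⟩
    apply h2
    intro u hu
    obtain ⟨_ | q, hq⟩ := h1 u hu
    · exact absurd hq.symm hu
    · exact ⟨q, hq⟩
  · simp only [ne_eq, h, not_false_eq_true, finsum_true]
    have hne : ∀ f : Q → U, (CoversExcept z fun o : Option Q => o.elim a f) →
        ¬ CoversExcept z f → ∀ q, f q ≠ a := by
      intro f h1 h2 q hq
      apply h2
      intro u hu
      obtain ⟨_ | q', hq'⟩ := h1 u hu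
      · exact ⟨q, hq.trans hq'⟩
      · exact ⟨q', hq'⟩
    refine Nat.card_congr
      { toFun := fun f => ⟨fun q => ⟨f.1 q, hne f.1 f.2.1 f.2.2 q⟩, ?_⟩
        invFun := fun f => ⟨fun q => f.1 q, ?_, ?_⟩
        left_inv := fun f => rfl
        right_inv := fun f => rfl }
    · rintro ⟨u, hua⟩ hu
      obtain ⟨_ | q, hq⟩ := f.2.1 u (fun h => hu (Subtype.ext h))
      · exact absurd hq.symm hua
      · exact ⟨q, Subtype.ext hq⟩
    · intro u hu
      by_cases hua : u = a
      · exact ⟨none, hua.symm⟩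
      · obtain ⟨q, hq⟩ := f.2 ⟨u, hua⟩ (fun h => hu (congrArg Subtype.val h))
        exact ⟨some q, congrArg Subtype.val hq⟩
    · intro hf
      obtain ⟨q, hq⟩ := hf a h
      exact (f.1 q).2 hq

/-- Sending one additional point to `z` turns `f` into a surjection from `|Q| + 1` points, and by
symmetry this accounts for one in `|U|` of all such surjections. The proof instead matches the
Stirling recurrence by induction on `Q`; `U` must vary, since the recursion removes a value from it.
-/
theorem card_coversExcept.{u, v} (Q : Type u) [Finite Q] : ∀ {U : Type v} [Finite U] (z : U),
    Nat.card {f : Q → U // CoversExcept z f} =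
      (Nat.card U - 1).factorial * Nat.stirlingSecond (Nat.card Q + 1) (Nat.card U) := by
  induction Q using Finite.induction_empty_option with
  | of_equiv e ih =>
    intro U _ z
    rw [← Nat.card_congr e, ← ih z]
    refine Nat.card_congr ((e.arrowCongr (Equiv.refl U)).subtypeEquiv fun f => ?_).symm
    refine forall₂_congr fun u _ => ?_
    exact ⟨fun ⟨q, hq⟩ => ⟨e q, by simpa using hq⟩, fun ⟨q, hq⟩ => ⟨e.symm q, by simpa using hq⟩⟩
  | h_empty =>
    intro U _ z
    by_cases h : ∀ u, u = z
    · have : Unique U := ⟨⟨z⟩, h⟩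
      have : Nonempty {f : PEmpty → U // CoversExcept z f} :=
        ⟨⟨fun _ => z, fun u hu => absurd (h u) hu⟩⟩
      rw [Nat.card_unique, Nat.card_unique]
      simp [Nat.stirlingSecond]
    · push Not at h
      obtain ⟨u, hu⟩ := h
      have : IsEmpty {f : PEmpty → U // CoversExcept z f} :=
        ⟨fun f => (f.2 u hu).elim fun q _ => q.elim⟩
      have h1 : 1 < Nat.card U := Finite.one_lt_card_iff_nontrivial.2 ⟨u, z, hu⟩
      rw [Nat.card_of_isEmpty, Nat.stirlingSecond_eq_zero_of_lt (by simpa using h1), mul_zero]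
  | @h_option Q _ ih =>
    intro U _ z
    classical
    have := Fintype.ofFinite U
    have hsplit : Nat.card {f : Option Q → U // CoversExcept z f} =
        ∑ a : U, Nat.card {f : Q → U // CoversExcept z fun o : Option Q => o.elim a f} := by
      rw [← Nat.card_sigma]
      refine Nat.card_congr
        { toFun := fun f => ⟨f.1 none, fun q => f.1 (some q), ?_⟩
          invFun := fun f => ⟨fun o => o.elim f.1 f.2.1, f.2.2⟩
          left_inv := fun f => Subtype.ext (funext fun o => by cases o <;> rfl)
          right_inv := fun f => rfl }
      convert f.2 using 1
      funext o
      cases o <;> rfl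
    have hterm : ∀ a : U,
        Nat.card {f : Q → U // CoversExcept z fun o : Option Q => o.elim a f} =
          (Nat.card U - 1).factorial * Nat.stirlingSecond (Nat.card Q + 1) (Nat.card U) +
            if a = z then 0 else
              (Nat.card U - 2).factorial * Nat.stirlingSecond (Nat.card Q + 1) (Nat.card U - 1) := by
      intro a
      rw [card_coversExcept_cons, ih z]
      congr 1
      split_ifs with h
      · simp [h]
      · have hc : Nat.card {u // u ≠ a} = Nat.card U - 1 := by
          rw [Nat.card_eq_fintype_card, Nat.card_eq_fintype_card, Fintype.card_subtype_compl,
            Fintype.card_subtype_eq]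
        simp only [ne_eq, h, not_false_eq_true, finsum_true]
        rw [ih, hc]
        rfl
    rw [hsplit, sum_congr rfl fun a _ => hterm a, sum_add_distrib, sum_ite, sum_const_zero,
      zero_add, sum_const, sum_const, filter_not, filter_eq' univ z, if_pos (mem_univ z),
      card_sdiff_of_subset (subset_univ _), card_singleton, card_univ, ← Nat.card_eq_fintype_card,
      Finite.card_option]
    obtain ⟨k, hk⟩ : ∃ k, Nat.card U = k + 1 :=
      Nat.exists_eq_succ_of_ne_zero (Nat.card_pos_iff.2 ⟨⟨z⟩, inferInstance⟩).ne'
    rw [hk, Nat.stirlingSecond_succ_succ (Nat.card Q + 1)]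
    simp only [smul_eq_mul, Nat.add_sub_cancel]
    -- When `U` is a singleton, `Nat.card U - 2` is truncated, but no `a ≠ z` exists and its term
    -- vanishes.
    cases k with
    | zero => simp [Nat.stirlingSecond]
    | succ k =>
      rw [show k + 1 + 1 - 2 = k by omega,
        Nat.factorial_succ]
      ring

end

end SemirigidComm

/-! ### Permutations with a given cycle type. -/

namespace SemirigidComm

open Finset

theorem weight_pos {r : ℕ} (l : r.Partition) : 0 < weight l := by
  refine Finset.prod_pos fun a ha => ?_
  have := l.parts_pos (Multiset.mem_toFinset.1 ha)
  positivity

/-- Separates the parts equal to `1`, whose factor is `μ₁!`, to reach the form used by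
`Equiv.Perm.card_of_cycleType_mul_eq`, where cycle types have no fixed points. -/
theorem weight_eq {r : ℕ} (l : r.Partition) :
    weight l = (r - (l.parts.filter (2 ≤ ·)).sum).factorial * (l.parts.filter (2 ≤ ·)).prod *
      ∏ a ∈ (l.parts.filter (2 ≤ ·)).toFinset, ((l.parts.filter (2 ≤ ·)).count a).factorial := by
  set m := l.parts.filter (2 ≤ ·) with hm
  have hone : l.parts.filter (fun a => ¬ 2 ≤ a) = Multiset.replicate (l.parts.count 1) 1 := by
    rw [← Multiset.filter_eq']
    refine Multiset.filter_congr fun a ha => ?_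
    have := l.parts_pos ha
    omega
  have hsplit : m + Multiset.replicate (l.parts.count 1) 1 = l.parts := by
    rw [← hone]
    exact Multiset.filter_add_not _ _
  have hc : r - m.sum = l.parts.count 1 := by
    have := l.parts_sum
    rw [← hsplit, Multiset.sum_add, Multiset.sum_replicate] at this
    simp only [smul_eq_mul, mul_one] at this
    omega
  have hcount : ∀ a ∈ m.toFinset, l.parts.count a = m.count a := by
    intro a ha
    rw [hm, Multiset.count_filter_of_pos (Multiset.of_mem_filter (Multiset.mem_toFinset.1 ha))]
  have h1 : 1 ∉ m.toFinset := by simp [hm]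
  have hw : weight l = ∏ a ∈ insert 1 m.toFinset,
      a ^ l.parts.count a * (l.parts.count a).factorial := by
    refine Finset.prod_subset ?_ ?_
    · intro a ha
      rw [Multiset.mem_toFinset] at ha
      have := l.parts_pos ha
      rw [mem_insert, Multiset.mem_toFinset, hm, Multiset.mem_filter]
      by_cases h : a = 1
      · exact Or.inl h
      · exact Or.inr ⟨ha, by omega⟩
    · intro a _ ha
      rw [Multiset.mem_toFinset] at ha
      simp [Multiset.count_eq_zero_of_notMem ha]
  rw [hw, Finset.prod_insert h1, one_pow, one_mul, hc, mul_assoc,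
    Finset.prod_multiset_count m, ← Finset.prod_mul_distrib]
  congr 1
  refine Finset.prod_congr rfl fun a ha => ?_
  rw [hcount a ha]

variable {α : Type*} [Fintype α] [DecidableEq α]

theorem partition_eq_iff (π : Equiv.Perm α) (l : (Fintype.card α).Partition) :
    π.partition = l ↔ π.cycleType = l.parts.filter (2 ≤ ·) := by
  constructor
  · rintro rfl
    exact Equiv.Perm.filter_parts_partition_eq_cycleType.symm
  · intro h
    have hone : l.parts.filter (fun a => ¬ 2 ≤ a) = Multiset.replicate (l.parts.count 1) 1 := by
      rw [← Multiset.filter_eq']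
      refine Multiset.filter_congr fun a ha => ?_
      have := l.parts_pos ha
      omega
    have hsplit : π.cycleType + Multiset.replicate (l.parts.count 1) 1 = l.parts := by
      rw [h, ← hone]
      exact Multiset.filter_add_not _ _
    apply Nat.Partition.ext
    rw [Equiv.Perm.parts_partition, ← hsplit]
    congr 2
    have := l.parts_sum
    rw [← hsplit, Multiset.sum_add, Multiset.sum_replicate, Equiv.Perm.sum_cycleType] at this
    simp only [smul_eq_mul, mul_one] at this
    rw [← hsplit] at this ⊢
    omega

theorem card_partition_eq_mul_weight (l : (Fintype.card α).Partition) :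
    #{π : Equiv.Perm α | π.partition = l} * weight l = (Fintype.card α).factorial := by
  simp only [partition_eq_iff]
  rw [weight_eq, Equiv.Perm.card_of_cycleType_mul_eq, if_pos]
  refine ⟨?_, fun a ha => Multiset.of_mem_filter ha⟩
  conv_rhs => rw [← l.parts_sum, ← Multiset.filter_add_not (2 ≤ ·) l.parts, Multiset.sum_add]
  exact Nat.le_add_right _ _

theorem sum_perm_partition (g : (Fintype.card α).Partition → ℚ) :
    ∑ π : Equiv.Perm α, g π.partition =
      (Fintype.card α).factorial * ∑ l, g l / weight l := by
  rw [← sum_fiberwise_of_maps_to (t := univ) (g := Equiv.Perm.partition) (by simp), mul_sum]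
  refine sum_congr rfl fun l _ => ?_
  rw [sum_congr rfl (g := fun _ => g l) (by intro x hx; rw [(mem_filter.1 hx).2]), sum_const,
    nsmul_eq_mul, ← card_partition_eq_mul_weight l]
  have : (weight l : ℚ) ≠ 0 := by exact_mod_cast (weight_pos l).ne'
  push_cast
  field_simp

end SemirigidComm

/-! ### Relabelling of operations, Burnside's lemma, and products. -/

namespace SemirigidComm

open Finset

section Transport

variable {S T : Type*} [Semigroup S] [Semigroup T]

theorem IsThreeNilpotent.of_mulEquiv (e : S ≃* T) (h : IsThreeNilpotent S) :
    IsThreeNilpotent T := by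
  obtain ⟨z, h1, h2, a, b, h3⟩ := h
  refine ⟨e z, fun t => ?_, fun t u v => ?_, e a, e b, ?_⟩
  · obtain ⟨t, rfl⟩ := e.surjective t
    rw [← map_mul, ← map_mul, (h1 t).1, (h1 t).2]
    exact ⟨rfl, rfl⟩
  · obtain ⟨t, rfl⟩ := e.surjective t
    obtain ⟨u, rfl⟩ := e.surjective u
    obtain ⟨v, rfl⟩ := e.surjective v
    rw [← map_mul, ← map_mul, h2]
  · rw [← map_mul]
    exact fun h => h3 (e.injective h)

theorem IsCommutative.of_mulEquiv (e : S ≃* T) (h : IsCommutative S) : IsCommutative T := by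
  intro t u
  obtain ⟨t, rfl⟩ := e.surjective t
  obtain ⟨u, rfl⟩ := e.surjective u
  rw [← map_mul, ← map_mul, h]

theorem IsSemirigid.of_mulEquiv (e : S ≃* T) (h : IsSemirigid S) : IsSemirigid T := by
  rintro φ _ ⟨t, u, rfl⟩
  obtain ⟨t, rfl⟩ := e.surjective t
  obtain ⟨u, rfl⟩ := e.surjective u
  have := h ((e.trans φ).trans e.symm) (t * u) ⟨t, u, rfl⟩
  rw [← map_mul]
  exact e.symm_apply_eq.1 this

end Transport

/-- The semigroup operation on `Fin n` for which `σ` is an isomorphism from `s`. -/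
abbrev transport {n : ℕ} (σ : Equiv.Perm (Fin n)) (s : Semigroup (Fin n)) : Semigroup (Fin n) :=
  @Equiv.semigroup _ _ σ.symm s

/-- `σ` as an isomorphism from `s` to its transport. -/
def transportEquiv {n : ℕ} (σ : Equiv.Perm (Fin n)) (s : Semigroup (Fin n)) :
    @MulEquiv (Fin n) (Fin n) s.toMul (transport σ s).toMul :=
  @MulEquiv.symm _ _ (transport σ s).toMul s.toMul (@Equiv.mulEquiv _ _ σ.symm s.toMul)

namespace Operation

variable {n : ℕ}

/-- The multiplication of an operation. -/
def op (s : Operation n) (a b : Fin n) : Fin n := @HMul.hMul _ _ _ (@instHMul _ s.1.toMul) a b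

theorem op_injective {s t : Operation n} (h : ∀ a b, s.op a b = t.op a b) : s = t := by
  apply Subtype.ext
  apply Semigroup.ext
  funext a b
  exact h a b

instance : MulAction (Equiv.Perm (Fin n)) (Operation n) where
  smul σ s := ⟨transport σ s.1,
    @IsThreeNilpotent.of_mulEquiv _ _ s.1 (transport σ s.1) (transportEquiv σ s.1) s.2.1,
    @IsCommutative.of_mulEquiv _ _ s.1 (transport σ s.1) (transportEquiv σ s.1) s.2.2.1,
    @IsSemirigid.of_mulEquiv _ _ s.1 (transport σ s.1) (transportEquiv σ s.1) s.2.2.2⟩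
  one_smul _ := op_injective fun _ _ => rfl
  mul_smul _ _ _ := op_injective fun _ _ => rfl

theorem smul_op (σ : Equiv.Perm (Fin n)) (s : Operation n) (a b : Fin n) :
    (σ • s).op (σ a) (σ b) = σ (s.op a b) := by
  change σ (s.op (σ.symm (σ a)) (σ.symm (σ b))) = _
  simp

theorem smul_eq_iff (σ : Equiv.Perm (Fin n)) (s t : Operation n) :
    σ • s = t ↔ ∀ a b, σ (s.op a b) = t.op (σ a) (σ b) := by
  constructor
  · rintro rfl a b
    exact (smul_op σ s a b).symm
  · intro h
    apply op_injective
    intro a b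
    obtain ⟨a, rfl⟩ := σ.surjective a
    obtain ⟨b, rfl⟩ := σ.surjective b
    rw [smul_op, h]

theorem isoSetoid_eq_orbitRel :
    isoSetoid n = MulAction.orbitRel (Equiv.Perm (Fin n)) (Operation n) := by
  ext s t
  rw [MulAction.orbitRel_apply, MulAction.mem_orbit_symm]
  constructor
  · rintro ⟨⟨e, he⟩⟩
    exact ⟨e, (smul_eq_iff _ _ _).2 he⟩
  · rintro ⟨σ, hσ⟩
    refine ⟨@MulEquiv.mk _ _ s.1.toMul t.1.toMul σ fun a b => ?_⟩
    exact (smul_eq_iff _ _ _).1 hσ a b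

instance : Finite (Operation n) := finite_operation n

/-- Burnside's lemma: isomorphism classes are the orbits under relabelling, and `σ` fixes `s`
exactly when `σ` is an automorphism of `s`. -/
theorem card_isoClass_mul_factorial :
    Nat.card (IsoClass n) * n.factorial =
      Nat.card {p : Equiv.Perm (Fin n) × Operation n // p.1 • p.2 = p.2} := by
  classical
  have := Fintype.ofFinite (Operation n)
  have := Fintype.ofFinite
    (Quotient (MulAction.orbitRel (Equiv.Perm (Fin n)) (Operation n)))
  have h := MulAction.sum_card_fixedBy_eq_card_orbits_mul_card_group (Equiv.Perm (Fin n))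
    (Operation n)
  rw [Fintype.card_perm, Fintype.card_fin] at h
  have h1 : Nat.card (IsoClass n) =
      Fintype.card (Quotient (MulAction.orbitRel (Equiv.Perm (Fin n)) (Operation n))) := by
    rw [← Nat.card_eq_fintype_card, IsoClass, isoSetoid_eq_orbitRel]
  rw [h1, ← h, ← Fintype.card_sigma, ← Nat.card_eq_fintype_card]
  exact Nat.card_congr
    { toFun := fun x => ⟨(x.1, x.2.1), x.2.2⟩
      invFun := fun x => ⟨x.1.1, x.1.2, x.2⟩
      left_inv := fun x => rfl
      right_inv := fun x => rfl }

/-- The zero element. -/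
noncomputable def zero (s : Operation n) : Fin n := s.2.1.choose

theorem zero_op (s : Operation n) (a : Fin n) : s.op s.zero a = s.zero :=
  (s.2.1.choose_spec.1 a).1

theorem op_op_left (s : Operation n) (a b c : Fin n) : s.op (s.op a b) c = s.zero :=
  s.2.1.choose_spec.2.1 a b c

theorem op_comm (s : Operation n) (a b : Fin n) : s.op a b = s.op b a := s.2.2.1 a b

theorem exists_op_ne_zero (s : Operation n) : ∃ a b, s.op a b ≠ s.zero :=
  s.2.1.choose_spec.2.2

/-- The point at which semirigidity enters. -/
theorem apply_op_of_smul_eq {s : Operation n} {σ : Equiv.Perm (Fin n)} (h : σ • s = s)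
    (a b : Fin n) : σ (s.op a b) = s.op a b := by
  refine s.2.2.2 (@MulEquiv.mk _ _ s.1.toMul s.1.toMul σ fun a b => ?_) _ ⟨a, b, rfl⟩
  exact (smul_eq_iff _ _ _).1 h a b

/-- The set of products, as a finset. -/
def products (s : Operation n) : Finset (Fin n) :=
  univ.image fun p : Fin n × Fin n => s.op p.1 p.2

theorem mem_products {s : Operation n} {c : Fin n} :
    c ∈ s.products ↔ ∃ a b, s.op a b = c := by
  simp [products]

theorem op_mem_products (s : Operation n) (a b : Fin n) : s.op a b ∈ s.products :=
  mem_products.2 ⟨a, b, rfl⟩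

theorem op_mem_of_products_eq {s : Operation n} {U : Finset (Fin n)} (h : s.products = U)
    (a b : Fin n) : s.op a b ∈ U := h ▸ s.op_mem_products a b

theorem zero_mem_products (s : Operation n) : s.zero ∈ s.products :=
  mem_products.2 ⟨_, _, s.zero_op s.zero⟩

theorem op_eq_zero_of_mem_left {s : Operation n} {a : Fin n} (h : a ∈ s.products) (b : Fin n) :
    s.op a b = s.zero := by
  obtain ⟨c, d, rfl⟩ := mem_products.1 h
  exact s.op_op_left c d b

theorem op_eq_zero_of_mem_right {s : Operation n} {b : Fin n} (h : b ∈ s.products) (a : Fin n) :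
    s.op a b = s.zero := by
  rw [op_comm, op_eq_zero_of_mem_left h]

theorem two_le_card_products (s : Operation n) : 2 ≤ #s.products := by
  obtain ⟨a, b, h⟩ := s.exists_op_ne_zero
  exact one_lt_card.2 ⟨_, s.op_mem_products a b, _, s.zero_mem_products, h⟩

theorem card_products_lt (s : Operation n) : #s.products < n := by
  obtain ⟨a, b, h⟩ := s.exists_op_ne_zero
  have : a ∉ s.products := fun ha => h (op_eq_zero_of_mem_left ha b)
  simpa using card_lt_univ_of_notMem this

theorem apply_eq_of_mem_products {s : Operation n} {σ : Equiv.Perm (Fin n)} (h : σ • s = s)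
    {a : Fin n} (ha : a ∈ s.products) : σ a = a := by
  obtain ⟨b, c, rfl⟩ := mem_products.1 ha
  exact apply_op_of_smul_eq h b c

theorem apply_notMem_products_iff {s : Operation n} {σ : Equiv.Perm (Fin n)} (h : σ • s = s)
    (a : Fin n) : σ a ∉ s.products ↔ a ∉ s.products := by
  refine not_congr ⟨fun ha => ?_, fun ha => ?_⟩
  · rwa [← σ.injective (apply_eq_of_mem_products h ha)]
  · rwa [apply_eq_of_mem_products h ha]

end Operation

/-! ### Automorphisms paired with operations, for a fixed set of products. -/

theorem apply_eq_of_mem_symCycle {α β : Type*} {π : Equiv.Perm α} {F : α × α → β}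
    (hF : ∀ x y, F (π x, π y) = F (x, y)) (hs : ∀ x y, F (x, y) = F (y, x)) {p q : α × α}
    (h : q ∈ symCycle π p) : F q = F p := by
  have hc : ∀ p q : α × α, q ∈ cCycle π p → F q = F p := by
    rintro ⟨x, y⟩ ⟨x', y'⟩ h
    obtain ⟨k, rfl, rfl⟩ := (mem_cCycle_iff_exists π _ _).1 h
    have hinv : ∀ x y, F (π⁻¹ x, π⁻¹ y) = F (x, y) := fun x y => by
      rw [← hF]; simp
    induction k using Int.induction_on generalizing x y with
    | zero => rfl
    | succ k ih =>
      rw [zpow_add_one, ← hF x y]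
      exact ih (π x) (π y) ((mem_cCycle_iff_exists π _ _).2 ⟨_, rfl, rfl⟩)
    | pred k ih =>
      rw [zpow_sub_one, ← hinv x y]
      exact ih (π⁻¹ x) (π⁻¹ y) ((mem_cCycle_iff_exists π _ _).2 ⟨_, rfl, rfl⟩)
  rcases h with h | h
  · exact hc _ _ h
  · exact (hc _ _ h).trans (hs _ _)

/-- An invariant function on pairs is a function on the `γ` classes `symCycle π p`, with the same
values. -/
theorem card_invariant_coversExcept {V U : Type*} [Fintype V] [DecidableEq V] [Finite U]
    (π : Equiv.Perm V) (z : U) :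
    Nat.card {g : V × V → U // (∀ p q, symCycle π p = symCycle π q → g p = g q) ∧
        CoversExcept z g} =
      (Nat.card U - 1).factorial *
        Nat.stirlingSecond (gamma π.partition + 1) (Nat.card U) := by
  rw [← ncard_range_symCycle, ← Nat.card_coe_set_eq, ← card_coversExcept]
  symm
  refine Nat.card_congr (Equiv.ofBijective (fun f =>
    ⟨fun p => f.1 ⟨symCycle π p, p, rfl⟩, fun p q h => by simp only [h], fun u hu => ?_⟩) ⟨?_, ?_⟩)
  · obtain ⟨⟨_, p, rfl⟩, hp⟩ := f.2 u hu
    exact ⟨p, hp⟩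
  · intro f f' h
    apply Subtype.ext
    funext ⟨_, p, rfl⟩
    exact congrFun (congrArg Subtype.val h) p
  · rintro ⟨g, h1, h2⟩
    have hval : ∀ p, g (⟨symCycle π p, p, rfl⟩ : Set.range (symCycle π)).2.choose = g p :=
      fun p => h1 _ _ (⟨symCycle π p, p, rfl⟩ : Set.range (symCycle π)).2.choose_spec
    refine ⟨⟨fun A => g A.2.choose, fun u hu => ?_⟩, Subtype.ext (funext hval)⟩
    obtain ⟨p, hp⟩ := h2 u hu
    exact ⟨⟨symCycle π p, p, rfl⟩, (hval p).trans hp⟩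

/-- The summand of the bound for generating sets of `r` elements in a semigroup of order `n`. -/
def boundTerm (n r : ℕ) : ℚ :=
  ∑ l : r.Partition, (Nat.stirlingSecond (gamma l + 1) (n - r) : ℚ) / (weight l : ℚ)

theorem card_sigma_invariant_coversExcept {V U : Type*} [Fintype V] [DecidableEq V] [Finite U]
    (z : U) {n r : ℕ} (hr : Fintype.card V = r) (hn : Nat.card U = n - r) :
    (Nat.card (Σ π : Equiv.Perm V,
      {g : V × V → U // (∀ p q, symCycle π p = symCycle π q → g p = g q) ∧
        CoversExcept z g}) : ℚ) =
      ((n - r - 1).factorial * r.factorial : ℕ) * boundTerm n r := by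
  subst hr
  rw [Nat.card_sigma]
  simp only [card_invariant_coversExcept, hn]
  push_cast
  rw [← mul_sum, sum_perm_partition
    (fun l => (Nat.stirlingSecond (gamma l + 1) (n - Fintype.card V) : ℚ)), boundTerm, mul_assoc]

open Operation in
-- Restriction to the complement of `U` embeds the pairs `(σ, s)` into pairs `(π, g)`. Only an
-- inequality results, because the operation built from `(π, g)` may have further automorphisms that
-- move products.
theorem card_automorphism_pairs_le {n : ℕ} (U : Finset (Fin n)) (z : Fin n) (hz : z ∈ U) :
    (Nat.card {p : Equiv.Perm (Fin n) × Operation n //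
        p.1 • p.2 = p.2 ∧ p.2.products = U ∧ p.2.zero = z} : ℚ) ≤
      ((#U - 1).factorial * (n - #U).factorial : ℕ) * boundTerm n (n - #U) := by
  have hle : #U ≤ n := by simpa using card_le_univ U
  have hsub : n - (n - #U) = #U := by omega
  have hV : Fintype.card {x // x ∉ U} = n - #U := by
    rw [Fintype.card_subtype_compl, Fintype.card_fin, Fintype.card_coe]
  have hU : Nat.card U = n - (n - #U) := by simp [hsub]
  have h := card_sigma_invariant_coversExcept (V := {x // x ∉ U}) (⟨z, hz⟩ : U) hV hU
  rw [hsub] at h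
  rw [← h]
  norm_cast
  let E := {e : Equiv.Perm {x // x ∉ U} × ({x // x ∉ U} × {x // x ∉ U} → U) //
    (∀ p q, symCycle e.1 p = symCycle e.1 q → e.2 p = e.2 q) ∧ CoversExcept ⟨z, hz⟩ e.2}
  have hE : Nat.card E = _ := Nat.card_congr
    { toFun := fun e : E => (⟨e.1.1, e.1.2, e.2⟩ : Σ π : Equiv.Perm {x // x ∉ U},
        {g : {x // x ∉ U} × {x // x ∉ U} → U //
          (∀ p q, symCycle π p = symCycle π q → g p = g q) ∧ CoversExcept ⟨z, hz⟩ g})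
      invFun := fun e => ⟨(e.1, e.2.1), e.2.2⟩
      left_inv := fun e => rfl
      right_inv := fun e => rfl }
  rw [← hE]
  refine Nat.card_le_card_of_injective (fun p =>
    (⟨(p.1.1.subtypePerm (p := fun x => x ∉ U) fun x => by
        have := apply_notMem_products_iff p.2.1 x
        rwa [p.2.2.1] at this,
      fun q => ⟨p.1.2.op q.1 q.2, op_mem_of_products_eq p.2.2.1 _ _⟩), ?_, ?_⟩ : E)) ?_
  · obtain ⟨⟨σ, s⟩, h1, h2, h3⟩ := p
    intro p q hpq
    refine (apply_eq_of_mem_symCycle (F := fun q : {x // x ∉ U} × {x // x ∉ U} =>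
      (⟨s.op q.1 q.2, op_mem_of_products_eq h2 _ _⟩ : U)) ?_ ?_
        ((mem_symCycle_iff _ p q).2 hpq.symm)).symm
    · intro x y
      apply Subtype.ext
      change s.op (σ x) (σ y) = s.op x y
      rw [← (smul_eq_iff _ _ _).1 h1, apply_op_of_smul_eq h1]
    · intro x y
      exact Subtype.ext (s.op_comm _ _)
  · obtain ⟨⟨σ, s⟩, h1, h2, h3⟩ := p
    dsimp only at h1 h2 h3
    rintro ⟨u, hu⟩ huz
    have hu' := hu
    rw [← h2] at hu'
    obtain ⟨a, b, rfl⟩ := mem_products.1 hu'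
    have hne : s.op a b ≠ s.zero := fun h => huz (Subtype.ext (h.trans h3))
    -- A nonzero product has both factors outside `U`, since products annihilate everything.
    refine ⟨(⟨a, fun ha => ?_⟩, ⟨b, fun hb => ?_⟩), rfl⟩
    · exact hne (op_eq_zero_of_mem_left (h2 ▸ ha) b)
    · exact hne (op_eq_zero_of_mem_right (h2 ▸ hb) a)
  · rintro ⟨⟨σ, s⟩, h1, h2, h3⟩ ⟨⟨τ, t⟩, h1', h2', h3'⟩ heq
    dsimp only at h1 h2 h3 h1' h2' h3'
    have heq' := Prod.ext_iff.1 (congrArg Subtype.val heq)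
    -- Nothing is lost by restricting: on `U` both permutations are the identity, and any product
    -- with a factor in `U` is `z`.
    have hσ : σ = τ := by
      ext1 x
      by_cases hx : x ∈ U
      · rw [apply_eq_of_mem_products h1 (h2 ▸ hx), apply_eq_of_mem_products h1' (h2' ▸ hx)]
      · exact congrArg Subtype.val (Equiv.congr_fun heq'.1 ⟨x, hx⟩)
    have hs : s = t := by
      apply op_injective
      intro a b
      by_cases ha : a ∈ U
      · rw [op_eq_zero_of_mem_left (h2 ▸ ha), op_eq_zero_of_mem_left (h2' ▸ ha), h3, h3']
      · by_cases hb : b ∈ U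
        · rw [op_eq_zero_of_mem_right (h2 ▸ hb), op_eq_zero_of_mem_right (h2' ▸ hb), h3, h3']
        · exact congrArg Subtype.val (congrFun heq'.2 (⟨a, ha⟩, ⟨b, hb⟩))
    subst hσ hs
    rfl

open Operation in
theorem card_automorphism_pairs_eq_sum (n : ℕ) :
    Nat.card {p : Equiv.Perm (Fin n) × Operation n // p.1 • p.2 = p.2} =
      ∑ U : Finset (Fin n), ∑ z : Fin n, Nat.card {p : Equiv.Perm (Fin n) × Operation n //
        p.1 • p.2 = p.2 ∧ p.2.products = U ∧ p.2.zero = z} := by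
  simp only [← Nat.card_sigma]
  exact Nat.card_congr
    { toFun := fun p => ⟨p.1.2.products, p.1.2.zero, p.1, p.2, rfl, rfl⟩
      invFun := fun p => ⟨p.2.2.1, p.2.2.2.1⟩
      left_inv := fun p => rfl
      right_inv := by
        rintro ⟨U, z, p, h, rfl, rfl⟩
        rfl }

/-- The `|U|` choices of `z` turn `(|U| - 1)!` into `|U|!`. A set of products contains zero and a
nonzero product, and omits the factors of the latter, whence `2 ≤ |U| < n`. -/
theorem sum_card_automorphism_pairs_le {n : ℕ} (U : Finset (Fin n)) :
    ((∑ z : Fin n, Nat.card {p : Equiv.Perm (Fin n) × Operation n //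
        p.1 • p.2 = p.2 ∧ p.2.products = U ∧ p.2.zero = z} : ℕ) : ℚ) ≤
      if 2 ≤ #U ∧ #U < n then
        ((#U).factorial * (n - #U).factorial : ℕ) * boundTerm n (n - #U) else 0 := by
  have hout : ∀ z ∉ U, Nat.card {p : Equiv.Perm (Fin n) × Operation n //
      p.1 • p.2 = p.2 ∧ p.2.products = U ∧ p.2.zero = z} = 0 := by
    intro z hz
    rw [Nat.card_eq_zero]
    refine Or.inl ⟨fun p => hz ?_⟩
    have := p.1.2.zero_mem_products
    rwa [p.2.2.1, p.2.2.2] at this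
  rw [← sum_subset (subset_univ U) fun z _ hz => hout z hz]
  split_ifs with h
  · push_cast
    refine (sum_le_sum fun z hz => card_automorphism_pairs_le U z hz).trans_eq ?_
    rw [sum_const, nsmul_eq_mul, ← Nat.mul_factorial_pred (n := #U) (by omega)]
    push_cast
    ring
  · rw [sum_eq_zero, Nat.cast_zero]
    intro z _
    rw [Nat.card_eq_zero]
    refine Or.inl ⟨fun p => h ?_⟩
    rw [← p.2.2.1]
    exact ⟨p.1.2.two_le_card_products, p.1.2.card_products_lt⟩

/-! ### Summation over all sets of products. -/

theorem card_isoClass_le (n : ℕ) :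
    (Nat.card (IsoClass n) : ℚ) ≤ ∑ r ∈ Icc 1 (n - 2), boundTerm n r := by
  have hn : (0 : ℚ) < n.factorial := by exact_mod_cast n.factorial_pos
  rw [← mul_le_mul_iff_left₀ hn]
  have h := Operation.card_isoClass_mul_factorial (n := n)
  rw [card_automorphism_pairs_eq_sum] at h
  rw [← Nat.cast_mul, h, Nat.cast_sum]
  refine (sum_le_sum fun U _ => sum_card_automorphism_pairs_le U).trans_eq ?_
  rw [← powerset_univ, sum_powerset_apply_card (fun k => if 2 ≤ k ∧ k < n then
    (k.factorial * (n - k).factorial : ℕ) * boundTerm n (n - k) else 0), sum_mul, card_univ,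
    Fintype.card_fin]
  simp only [smul_ite, smul_zero]
  rw [← sum_filter]
  -- With `r = n - k`, the range `2 ≤ k < n` becomes `1 ≤ r ≤ n - 2`, and the binomial coefficient
  -- counting the sets `U` of size `k` completes the factorials to `n!`.
  refine sum_nbij' (fun k => n - k) (fun r => n - r) ?_ ?_ ?_ ?_ ?_
  · intro k hk
    simp only [mem_filter, mem_range, mem_Icc] at hk ⊢
    omega
  · intro k hk
    simp only [mem_filter, mem_range, mem_Icc] at hk ⊢
    omega
  · intro k hk
    simp only [mem_filter, mem_range] at hk
    omega
  · intro k hk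
    simp only [mem_Icc] at hk
    omega
  · intro k hk
    simp only [mem_filter, mem_range] at hk
    rw [nsmul_eq_mul, ← Nat.choose_mul_factorial_mul_factorial (n := n) (k := k) (by omega)]
    push_cast
    ring

end SemirigidComm

theorem mainTheorem5 :
    (∀ n : ℕ, (Nat.card (SemirigidComm.IsoClass n) : ℚ) ≤
      ∑ r ∈ Finset.Icc 1 (n - 2), ∑ l : r.Partition,
        (Nat.stirlingSecond (SemirigidComm.gamma l + 1) (n - r) : ℚ) /
          (SemirigidComm.weight l : ℚ)) ∧
    (∀ (r : ℕ) (l : r.Partition) (π : Equiv.Perm (Fin r)), π.partition.parts = l.parts →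
      (SemirigidComm.cCycles π).ncard = SemirigidComm.beta l ∧
      {A ∈ SemirigidComm.cCycles π | SemirigidComm.IsSymmetrical A}.ncard =
        SemirigidComm.delta l) := by
  refine ⟨SemirigidComm.card_isoClass_le, fun r l π h => ?_⟩
  rw [SemirigidComm.ncard_cCycles, SemirigidComm.ncard_symmetrical_cCycles,
    SemirigidComm.beta, SemirigidComm.delta, h]
  exact ⟨rfl, rfl⟩
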